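/- For integers $0\le k\le n$ let $[n]=\{1,\dots,n\}$ and let $\binom{[n]}{k}$ be the collection of all $k$-element subsets of $[n]$. Call two families $\mathcal A,\mathcal B\subset\binom{[n]}{k}$ $s$-cross-intersecting if $|A\cap B|\ge s$ for all $A\in\mathcal A$ and $B\in\mathcal B$. Let $n,k,s$ be integers with $k>s\ge 1$ and $n>2k-s$, and put $\mathcal C=\{C\in\binom{[n]}{k}: |C\cap[k]|\ge s\}$. Then $$\max\bigl(|\mathcal A|+|\mathcal B|\bigr)=|\mathcal C|+1,$$ where the maximum is over all pairs of non-empty $s$-cross-intersecting families $\mathcal A,\mathcal B\subset\binom{[n]}{k}$. -/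

import Mathlib

/-- The collection of all `k`-element subsets of `[n] = {1, …, n}`. -/
def kSubsets (n k : ℕ) : Finset (Finset ℕ) :=
  Finset.powersetCard k (Finset.Icc 1 n)

/-- Two families are `s`-cross-intersecting if `|A ∩ B| ≥ s` for all members `A` of the first
and `B` of the second. -/
def CrossIntersecting (s : ℕ) (𝒜 ℬ : Finset (Finset ℕ)) : Prop :=
  ∀ A ∈ 𝒜, ∀ B ∈ ℬ, s ≤ (A ∩ B).card

/-- The family of all `k`-element subsets `C` of `[n]` with `|C ∩ [k]| ≥ s`. -/
def familyC (n k s : ℕ) : Finset (Finset ℕ) :=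
  (kSubsets n k).filter fun C => s ≤ (C ∩ Finset.Icc 1 k).card

/-! Join two `k`-sets when they meet in fewer than `s` elements. Cross-intersection says that `ℬ`
avoids the neighbourhood N(`𝒜`), so it suffices that, among nonempty families whose neighbourhood is
not everything, the expansion |N(A)| - |A| is at least that of a singleton. Expansion is submodular,
which forces a smallest minimiser to be a block of the symmetric group
(`card_add_le_card_relNeighbors_of_blocks`). A block is everything, a singleton or a complementary
pair (`eq_univ_of_block`): the first has full neighbourhood, the other two are checked directly. -/

/-- The set of elements related to some member of `A`. -/
def relNeighbors {X : Type*} [Fintype X] (R : X → X → Prop) [DecidableRel R]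
    (A : Finset X) : Finset X :=
  Finset.univ.filter fun y => ∃ x ∈ A, R x y

/-! ### Expansion in a symmetric relation with a group action -/

section Fragments

open Finset
open scoped Pointwise

variable {X : Type*} [Fintype X] {R : X → X → Prop} [DecidableRel R]

theorem mem_relNeighbors {A : Finset X} {y : X} :
    y ∈ relNeighbors R A ↔ ∃ x ∈ A, R x y := by
  simp [relNeighbors]

variable [DecidableEq X]

theorem relNeighbors_union (A B : Finset X) :
    relNeighbors R (A ∪ B) = relNeighbors R A ∪ relNeighbors R B := by
  ext y
  simp only [mem_union, mem_relNeighbors]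
  grind

theorem relNeighbors_inter_subset (A B : Finset X) :
    relNeighbors R (A ∩ B) ⊆ relNeighbors R A ∩ relNeighbors R B := by
  intro y
  simp only [mem_inter, mem_relNeighbors]
  grind

theorem card_relNeighbors_union_add_inter_le (A B : Finset X) :
    (relNeighbors R (A ∪ B)).card + (relNeighbors R (A ∩ B)).card ≤
      (relNeighbors R A).card + (relNeighbors R B).card := by
  rw [relNeighbors_union, ← card_union_add_card_inter (relNeighbors R A)]
  exact Nat.add_le_add_left (card_le_card (relNeighbors_inter_subset A B)) _

/-- Duality: passing from `A` to the complement of its neighbourhood does not increase expansion. -/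
theorem relNeighbors_compl_subset (hsymm : ∀ x y, R x y → R y x) (A : Finset X) :
    relNeighbors R (relNeighbors R A)ᶜ ⊆ Aᶜ := by
  intro y
  simp only [mem_compl, mem_relNeighbors]
  rintro ⟨x, hx, hxy⟩ hy
  exact hx ⟨y, hy, hsymm _ _ hxy⟩

variable {G : Type*} [Group G] [MulAction G X]

theorem relNeighbors_smul (hG : ∀ (g : G) x y, R x y → R (g • x) (g • y)) (g : G)
    (A : Finset X) : relNeighbors R (g • A) = g • relNeighbors R A := by
  ext y
  simp only [mem_relNeighbors, ← inv_smul_mem_iff]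
  constructor
  · rintro ⟨x, hx, hxy⟩
    exact ⟨g⁻¹ • x, hx, hG _ _ _ hxy⟩
  · rintro ⟨x, hx, hxy⟩
    exact ⟨g • x, by simpa using hx, by simpa using hG g _ _ hxy⟩

/-- For a symmetric relation invariant under a group action, a lower bound for the expansion
`|N(A)| - |A|` that holds for all blocks `A` holds for all sets `A`. -/
theorem card_add_le_card_relNeighbors_of_blocks (hsymm : ∀ x y, R x y → R y x)
    (hG : ∀ (g : G) x y, R x y → R (g • x) (g • y)) (d : ℕ)
    (hblock : ∀ A : Finset X, A.Nonempty → relNeighbors R A ≠ univ →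
      (∀ g : G, (A ∩ g • A).Nonempty → g • A = A) → d + A.card ≤ (relNeighbors R A).card + 1)
    {A : Finset X} (hA : A.Nonempty) (hN : relNeighbors R A ≠ univ) :
    d + A.card ≤ (relNeighbors R A).card + 1 := by
  classical
  set F : Finset (Finset X) := univ.filter fun B => B.Nonempty ∧ relNeighbors R B ≠ univ with hF
  have hmemF : ∀ B, B ∈ F ↔ B.Nonempty ∧ relNeighbors R B ≠ univ := by simp [hF]
  let e : Finset X → ℤ := fun B => (relNeighbors R B).card - B.card
  obtain ⟨B₀, hB₀F, hB₀⟩ := exists_min_image F e ⟨A, (hmemF A).2 ⟨hA, hN⟩⟩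
  obtain ⟨B, hBF, hB⟩ := exists_min_image (F.filter fun B => e B = e B₀) card
    ⟨B₀, by simp [hB₀F]⟩
  rw [mem_filter, hmemF] at hBF
  obtain ⟨⟨hBne, hBN⟩, hBe⟩ := hBF
  have hmin : ∀ C, C.Nonempty → relNeighbors R C ≠ univ → e B ≤ e C := fun C h1 h2 =>
    hBe ▸ hB₀ C ((hmemF C).2 ⟨h1, h2⟩)
  have hmin' : ∀ C, C.Nonempty → relNeighbors R C ≠ univ → e C ≤ e B → B.card ≤ C.card := by
    intro C h1 h2 h3
    refine hB C (mem_filter.2 ⟨(hmemF C).2 ⟨h1, h2⟩, ?_⟩)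
    exact hBe ▸ le_antisymm h3 (hmin C h1 h2)
  have hkey : d + B.card ≤ (relNeighbors R B).card + 1 := by
    refine hblock B hBne hBN fun g hg => ?_
    by_contra hne
    -- By duality this complement is also a minimiser, and `B` is a smallest one.
    have hdual : B.card ≤ ((relNeighbors R B)ᶜ).card := by
      have hsub := relNeighbors_compl_subset hsymm B
      apply hmin'
      · rwa [nonempty_iff_ne_empty, Ne, compl_eq_empty_iff]
      · intro h
        rw [h] at hsub
        obtain ⟨x, hx⟩ := hBne
        exact mem_compl.1 (hsub (mem_univ x)) hx
      · have h1 := card_le_card hsub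
        have h2 := card_add_card_compl B
        have h3 := card_add_card_compl (relNeighbors R B)
        simp only [e]
        omega
    have h3 := card_add_card_compl (relNeighbors R B)
    have hcardg : (g • B).card = B.card := card_smul_finset g B
    have hlt : (B ∩ g • B).card < B.card := by
      refine card_lt_card ⟨inter_subset_left, fun h => hne ?_⟩
      exact (eq_of_subset_of_card_le (h.trans inter_subset_right) hcardg.le).symm
    have hNi : relNeighbors R (B ∩ g • B) ≠ univ := by
      intro h
      refine hBN (eq_univ_of_forall fun y => ?_)
      exact (mem_inter.1 (relNeighbors_inter_subset B (g • B) (h ▸ mem_univ y))).1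
    have hgt : e B < e (B ∩ g • B) := by
      by_contra hle
      exact absurd (hmin' _ hg hNi (not_lt.1 hle)) (not_le.2 hlt)
    have hsub := card_relNeighbors_union_add_inter_le (R := R) B (g • B)
    have hui := card_union_add_card_inter B (g • B)
    rw [relNeighbors_smul hG, card_smul_finset] at hsub
    have hpos : 0 < (B ∩ g • B).card := hg.card_pos
    -- Otherwise submodularity and `hgt` would make the complement of N(`B`) smaller than `B`,
    -- against `hdual`.
    have hNu : relNeighbors R (B ∪ g • B) ≠ univ := by
      intro h
      rw [h, card_univ] at hsub
      simp only [e] at hgt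
      omega
    have := hmin _ (hBne.mono subset_union_left) hNu
    simp only [e] at this hgt
    omega
  have := hmin A hA hN
  simp only [e] at this
  omega

end Fragments

/-! ### Blocks of `k`-sets and the expansion bound -/

section PowersetCard

open Finset
open scoped Pointwise

variable {α : Type*} [DecidableEq α] {k : ℕ}

theorem swap_smul_powersetCard_eq {S : Set.powersetCard α k} {a b : α}
    (h : a ∈ (S : Finset α) ↔ b ∈ (S : Finset α)) : Equiv.swap a b • S = S := by
  apply Subtype.ext
  rw [Set.powersetCard.coe_smul]
  ext x
  rw [← inv_smul_mem_iff, Equiv.swap_inv, Equiv.Perm.smul_def, Equiv.swap_apply_def]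
  split_ifs with h1 h2 <;> grind

variable [Fintype α]

/-- A block of the action of the symmetric group on `k`-subsets that contains two distinct
non-complementary sets is everything. -/
theorem eq_univ_of_block {A : Finset (Set.powersetCard α k)}
    (hblock : ∀ g : Equiv.Perm α, (A ∩ g • A).Nonempty → g • A = A)
    {S T : Set.powersetCard α k} (hS : S ∈ A) (hT : T ∈ A) (hne : S ≠ T)
    (hcompl : (T : Finset α) ≠ (S : Finset α)ᶜ) : A = univ := by
  have hfix : ∀ (U : Set.powersetCard α k), U ∈ A → ∀ a b : α,
      (a ∈ (U : Finset α) ↔ b ∈ (U : Finset α)) → Equiv.swap a b • A = A := by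
    intro U hU a b h
    refine hblock _ ⟨U, mem_inter.2 ⟨hU, ?_⟩⟩
    have := smul_mem_smul_finset (a := Equiv.swap a b) hU
    rwa [swap_smul_powersetCard_eq h] at this
  have htrans : ∀ a b c : α, Equiv.swap a b • A = A → Equiv.swap b c • A = A →
      Equiv.swap a c • A = A := by
    intro a b c hab hbc
    by_cases hac : a = c
    · rw [hac, Equiv.swap_self]
      exact one_smul _ A
    by_cases hbc' : b = c
    · rwa [← hbc']
    rw [← Equiv.swap_mul_swap_mul_swap (x := c) (y := b) (z := a) (Ne.symm hbc') (Ne.symm hac),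
      mul_smul, mul_smul, Equiv.swap_comm b a, Equiv.swap_comm c b, hab, hbc, hab]
  have hSn : ∃ a ∈ (S : Finset α), a ∉ (T : Finset α) :=
    (Set.powersetCard.exists_mem_notMem_iff_ne S T).1 hne
  have hTn : ∃ a ∈ (T : Finset α), a ∉ (S : Finset α) :=
    (Set.powersetCard.exists_mem_notMem_iff_ne T S).1 hne.symm
  -- Transpositions within `T` or within its complement also fix `A`; if none crossed `S`, then `T`
  -- would be the complement of `S`.
  have hcross : ∃ a ∈ (S : Finset α), ∃ b ∉ (S : Finset α), Equiv.swap a b • A = A := by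
    by_contra! hcon
    refine hcompl (Finset.ext fun x => ?_)
    obtain ⟨a, haS, haT⟩ := hSn
    obtain ⟨b, hbT, hbS⟩ := hTn
    rw [mem_compl]
    constructor
    · intro hxT hxS
      exact hcon x hxS b hbS (hfix T hT x b (by simp [hxT, hbT]))
    · intro hxS
      by_contra hxT
      exact hcon a haS x hxS (hfix T hT a x (by simp [hxT, haT]))
  obtain ⟨a, ha, b, hb, hab⟩ := hcross
  have hall : ∀ x y : α, Equiv.swap x y • A = A := by
    have hxa : ∀ x : α, Equiv.swap x a • A = A := by
      intro x
      by_cases hx : x ∈ (S : Finset α)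
      · exact hfix S hS x a (by simp [hx, ha])
      · exact htrans x b a (hfix S hS x b (by simp [hx, hb])) (by rwa [Equiv.swap_comm])
    intro x y
    exact htrans x a y (hxa x) (by rw [Equiv.swap_comm]; exact hxa y)
  have htop : ∀ g : Equiv.Perm α, g • A = A := by
    intro g
    have hle : Subgroup.closure {σ : Equiv.Perm α | σ.IsSwap} ≤ MulAction.stabilizer _ A := by
      rw [Subgroup.closure_le]
      rintro _ ⟨x, y, -, rfl⟩
      exact hall x y
    rw [Equiv.Perm.closure_isSwap] at hle
    exact hle (Subgroup.mem_top g)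
  refine eq_univ_of_forall fun U => ?_
  have := Set.powersetCard.isPretransitive (α := α) (n := k)
  obtain ⟨g, rfl⟩ := MulAction.exists_smul_eq (Equiv.Perm α) S U
  rw [← htop g]
  exact smul_mem_smul_finset hS

/-- Choose `T` inside the complement of `S`, or containing it if it is too small. Hence the family
of all `k`-sets has full neighbourhood. -/
theorem exists_powersetCard_inter_lt {s : ℕ} (hs : 1 ≤ s)
    (hn : 2 * k < Fintype.card α + s) (S : Set.powersetCard α k) :
    ∃ T : Set.powersetCard α k, ((S : Finset α) ∩ T).card < s := by
  have hc := card_add_card_compl (S : Finset α)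
  rw [Set.powersetCard.card_eq] at hc
  rcases le_total k ((S : Finset α)ᶜ).card with h | h
  · obtain ⟨T, hT, hTc⟩ := exists_subset_card_eq h
    refine ⟨⟨T, hTc⟩, ?_⟩
    have : (S : Finset α) ∩ T = ∅ := by
      rw [← disjoint_iff_inter_eq_empty, disjoint_left]
      exact fun x hxS hxT => mem_compl.1 (hT hxT) hxS
    simp only [this, card_empty]
    omega
  · obtain ⟨T, hT, hTc⟩ := exists_superset_card_eq h (by omega)
    refine ⟨⟨T, hTc⟩, ?_⟩
    have h1 : (S : Finset α) ∩ T = T \ (S : Finset α)ᶜ := by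
      ext x
      simp [and_comm]
    have h2 := card_sdiff_add_card_eq_card hT
    simp only [h1]
    omega

/-- Any nonempty family `A` of `k`-sets whose neighbourhood, in the graph joining sets that meet
in fewer than `s` elements, is not everything has expansion `|N(A)| - |A|` at least that of a
singleton. -/
theorem card_add_le_card_relNeighbors_powersetCard {s : ℕ} (hs : 1 ≤ s) (hsk : s < k)
    (hn : 2 * k < Fintype.card α + s) {A : Finset (Set.powersetCard α k)} (hA : A.Nonempty)
    (hN : relNeighbors (fun S T : Set.powersetCard α k => ((S : Finset α) ∩ T).card < s) A ≠ univ)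
    (S₀ : Set.powersetCard α k) :
    (univ.filter fun T : Set.powersetCard α k => ((S₀ : Finset α) ∩ T).card < s).card + A.card ≤
      (relNeighbors (fun S T : Set.powersetCard α k => ((S : Finset α) ∩ T).card < s) A).card
        + 1 := by
  have hG : ∀ (g : Equiv.Perm α) (x y : Set.powersetCard α k), ((x : Finset α) ∩ y).card < s →
      (((g • x : Set.powersetCard α k) : Finset α) ∩ (g • y : Set.powersetCard α k)).card < s := by
    intro g x y h
    rwa [Set.powersetCard.coe_smul, Set.powersetCard.coe_smul, ← smul_finset_inter,
      card_smul_finset]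
  refine card_add_le_card_relNeighbors_of_blocks (G := Equiv.Perm α)
    (fun x y h => by rwa [inter_comm]) hG _ (fun B hB hBN hblock => ?_) hA hN
  obtain ⟨S, hS⟩ := hB
  have hdeg : (univ.filter fun T : Set.powersetCard α k => ((S₀ : Finset α) ∩ T).card < s).card =
      (univ.filter fun T : Set.powersetCard α k => ((S : Finset α) ∩ T).card < s).card := by
    have := Set.powersetCard.isPretransitive (α := α) (n := k)
    obtain ⟨g, rfl⟩ := MulAction.exists_smul_eq (Equiv.Perm α) S₀ S
    refine card_bij' (fun T _ => g • T) (fun T _ => g⁻¹ • T) ?_ ?_ ?_ ?_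
    · intro T hT
      simp only [mem_filter, mem_univ, true_and] at hT ⊢
      exact hG g _ _ hT
    · intro T hT
      simp only [mem_filter, mem_univ, true_and] at hT ⊢
      simpa only [inv_smul_smul] using hG g⁻¹ _ _ hT
    · simp
    · simp
  rw [hdeg]
  have hsub : (univ.filter fun T : Set.powersetCard α k => ((S : Finset α) ∩ T).card < s) ⊆
      relNeighbors (fun S T : Set.powersetCard α k => ((S : Finset α) ∩ T).card < s) B := by
    intro T hT
    rw [mem_filter] at hT
    exact mem_relNeighbors.2 ⟨S, hS, hT.2⟩
  by_cases hsingle : B = {S}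
  · have := card_le_card hsub
    rw [hsingle] at this ⊢
    simpa using this
  have hBc : ∀ T ∈ B, T ≠ S → (T : Finset α) = (S : Finset α)ᶜ := by
    intro T hT hTS
    by_contra hc
    refine hBN (eq_univ_of_forall fun U => ?_)
    rw [mem_relNeighbors, eq_univ_of_block hblock hS hT hTS.symm hc]
    obtain ⟨V, hV⟩ := exists_powersetCard_inter_lt hs hn U
    exact ⟨V, mem_univ _, by rwa [inter_comm]⟩
  obtain ⟨T, hT, hTS⟩ : ∃ T ∈ B, T ≠ S := by
    by_contra! h
    exact hsingle (eq_singleton_iff_unique_mem.2 ⟨hS, h⟩)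
  have hB2 : B.card ≤ 2 := by
    refine (card_le_card (t := {S, T}) fun U hU => ?_).trans card_le_two
    by_cases hUS : U = S
    · simp [hUS]
    · have : U = T := Subtype.ext ((hBc U hU hUS).trans (hBc T hT hTS).symm)
      simp [this]
  -- For a complementary pair, `S` is a neighbour of `T` but not of itself; this extra neighbour
  -- pays for the second member.
  have hSN : S ∈ relNeighbors
      (fun S T : Set.powersetCard α k => ((S : Finset α) ∩ T).card < s) B := by
    refine mem_relNeighbors.2 ⟨T, hT, ?_⟩
    rw [hBc T hT hTS, inter_comm, inter_compl, card_empty]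
    omega
  have hlt := card_lt_card (ssubset_iff_of_subset hsub |>.2 ⟨S, hSN, by
    simp only [mem_filter, inter_self, Set.powersetCard.card_eq]; omega⟩)
  omega

/-- Upper bound for nonempty cross-intersecting families of `k`-subsets of a finite type. -/
theorem card_add_card_le_of_crossIntersecting_powersetCard {s : ℕ} (hs : 1 ≤ s) (hsk : s < k)
    (hn : 2 * k < Fintype.card α + s) {A B : Finset (Set.powersetCard α k)} (hA : A.Nonempty)
    (hB : B.Nonempty) (hAB : ∀ S ∈ A, ∀ T ∈ B, s ≤ ((S : Finset α) ∩ T).card)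
    (S₀ : Set.powersetCard α k) :
    A.card + B.card ≤
      (univ.filter fun T : Set.powersetCard α k => s ≤ ((S₀ : Finset α) ∩ T).card).card + 1 := by
  set N := relNeighbors (fun S T : Set.powersetCard α k => ((S : Finset α) ∩ T).card < s) A
    with hNdef
  have hdisj : Disjoint B N := by
    rw [disjoint_left]
    intro T hT hTN
    obtain ⟨S, hS, hST⟩ := mem_relNeighbors.1 hTN
    exact absurd (hAB S hS T hT) (not_le.2 hST)
  have hN : N ≠ univ := by
    rintro h
    obtain ⟨T, hT⟩ := hB
    exact disjoint_left.1 hdisj hT (h ▸ mem_univ T)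
  have h1 := card_add_le_card_relNeighbors_powersetCard hs hsk hn hA hN S₀
  have h2 := card_le_univ (B ∪ N)
  rw [card_union_of_disjoint hdisj] at h2
  have h3 := card_filter_add_card_filter_not (s := (univ : Finset (Set.powersetCard α k)))
    (fun T => s ≤ ((S₀ : Finset α) ∩ T).card)
  simp only [not_le, card_univ] at h3
  rw [← hNdef] at h1
  omega

end PowersetCard

/-! ### Transfer to subsets of `[n]`, and sharpness -/

section Transfer

open Finset

/-- A `k`-subset of `ℕ` contained in `I`, as a `k`-subset of the subtype `I`. -/
def restrictPowersetCard {I : Finset ℕ} {k : ℕ} (S : {S // S ∈ powersetCard k I}) :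
    Set.powersetCard I k :=
  ⟨S.1.subtype (· ∈ I), by
    have h := mem_powersetCard.1 S.2
    rw [Set.powersetCard.mem_iff, card_subtype, filter_true_of_mem fun x hx => h.1 hx, h.2]⟩

theorem map_restrictPowersetCard {I : Finset ℕ} {k : ℕ} (S : {S // S ∈ powersetCard k I}) :
    (restrictPowersetCard S : Finset I).map (Function.Embedding.subtype _) = S.1 :=
  subtype_map_of_mem fun _ hx => (mem_powersetCard.1 S.2).1 hx

theorem restrictPowersetCard_injective {I : Finset ℕ} {k : ℕ} :
    Function.Injective (restrictPowersetCard (I := I) (k := k)) := by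
  intro S T h
  apply Subtype.ext
  rw [← map_restrictPowersetCard S, h, map_restrictPowersetCard]

theorem card_restrictPowersetCard_inter {I : Finset ℕ} {k : ℕ}
    (S T : {S // S ∈ powersetCard k I}) :
    ((restrictPowersetCard S : Finset I) ∩ restrictPowersetCard T).card = (S.1 ∩ T.1).card := by
  rw [← card_map (Function.Embedding.subtype _), map_inter, map_restrictPowersetCard,
    map_restrictPowersetCard]

theorem card_add_card_le_of_crossIntersecting {n k s : ℕ} (hs : 1 ≤ s) (hsk : s < k)
    (hn : 2 * k < n + s) {𝒜 ℬ : Finset (Finset ℕ)} (h𝒜 : 𝒜 ⊆ kSubsets n k)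
    (hℬ : ℬ ⊆ kSubsets n k) (hA : 𝒜.Nonempty) (hB : ℬ.Nonempty)
    (hAB : CrossIntersecting s 𝒜 ℬ) : 𝒜.card + ℬ.card ≤ (familyC n k s).card + 1 := by
  let lift : Finset (Finset ℕ) → Finset (Set.powersetCard (Icc 1 n) k) := fun 𝒞 =>
    (𝒞.subtype (· ∈ powersetCard k (Icc 1 n))).map ⟨_, restrictPowersetCard_injective⟩
  have hmem : ∀ (𝒞 : Finset (Finset ℕ)) U, U ∈ lift 𝒞 ↔
      ∃ S : {S // S ∈ powersetCard k (Icc 1 n)}, S.1 ∈ 𝒞 ∧ restrictPowersetCard S = U := by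
    intro 𝒞 U
    simp [lift]
  have hcard : ∀ 𝒞, 𝒞 ⊆ kSubsets n k → (lift 𝒞).card = 𝒞.card := by
    intro 𝒞 h
    rw [card_map, card_subtype, filter_true_of_mem]
    exact fun x hx => h hx
  have hne : ∀ 𝒞, 𝒞 ⊆ kSubsets n k → 𝒞.Nonempty → (lift 𝒞).Nonempty := by
    intro 𝒞 h h'
    rw [← card_pos, hcard 𝒞 h]
    exact h'.card_pos
  have hk : Icc 1 k ∈ powersetCard k (Icc 1 n) :=
    mem_powersetCard.2 ⟨Icc_subset_Icc le_rfl (by omega), by simp⟩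
  have hmain := card_add_card_le_of_crossIntersecting_powersetCard hs hsk (by simpa using hn)
    (hne 𝒜 h𝒜 hA) (hne ℬ hℬ hB) (by
      intro S hS T hT
      obtain ⟨S, hS', rfl⟩ := (hmem _ _).1 hS
      obtain ⟨T, hT', rfl⟩ := (hmem _ _).1 hT
      rw [card_restrictPowersetCard_inter]
      exact hAB _ hS' _ hT') (restrictPowersetCard ⟨Icc 1 k, hk⟩)
  rw [hcard 𝒜 h𝒜, hcard ℬ hℬ] at hmain
  refine hmain.trans (Nat.add_le_add_right ?_ 1)
  refine card_le_card_of_injOn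
    (fun U => (U : Finset (Icc 1 n)).map (Function.Embedding.subtype _)) ?_ ?_
  · intro U hU
    simp only [coe_filter, mem_univ, true_and, Set.mem_ofPred_eq] at hU
    simp only [familyC, kSubsets, coe_filter, Set.mem_ofPred_eq, mem_powersetCard, card_map]
    refine ⟨⟨fun x hx => ?_, Set.powersetCard.card_eq U⟩, ?_⟩
    · obtain ⟨y, -, rfl⟩ := mem_map.1 hx
      exact y.2
    · rwa [← card_map (Function.Embedding.subtype _), map_inter, map_restrictPowersetCard,
        inter_comm] at hU
  · intro U _ V _ h
    exact Subtype.ext (map_injective _ h)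

end Transfer

theorem theorem3 (n k s : ℕ) (hs : 1 ≤ s) (hsk : s < k) (hn : 2 * k < n + s) :
    IsGreatest
      {m : ℕ | ∃ 𝒜 ℬ : Finset (Finset ℕ), 𝒜 ⊆ kSubsets n k ∧ ℬ ⊆ kSubsets n k ∧
        𝒜.Nonempty ∧ ℬ.Nonempty ∧ CrossIntersecting s 𝒜 ℬ ∧ m = 𝒜.card + ℬ.card}
      ((familyC n k s).card + 1) := by
  have hk : Finset.Icc 1 k ∈ kSubsets n k :=
    Finset.mem_powersetCard.2 ⟨Finset.Icc_subset_Icc le_rfl (by omega), by simp⟩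
  constructor
  · refine ⟨{Finset.Icc 1 k}, familyC n k s, by simpa using hk, Finset.filter_subset _ _,
      by simp, ⟨Finset.Icc 1 k, Finset.mem_filter.2 ⟨hk, by simpa using hsk.le⟩⟩, ?_, ?_⟩
    · intro A hA B hB
      rw [Finset.mem_singleton] at hA
      rw [hA, Finset.inter_comm]
      exact (Finset.mem_filter.1 hB).2
    · rw [Finset.card_singleton, add_comm]
  · rintro m ⟨𝒜, ℬ, h𝒜, hℬ, hA, hB, hAB, rfl⟩
    exact card_add_card_le_of_crossIntersecting hs hsk hn h𝒜 hℬ hA hB hAB
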